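/- Let $\mathcal D$ be the set of pairs $(u,\mu)$ such that - $u\in E_2$, i.e. $u=f+a\chi^++b\chi^-$ with $f\in H^1(\mathbb R)$ (continuous representative), $a,b\in\mathbb R$; - $\mu$ is a finite nonnegative Borel measure on $\mathbb R$; - $\mu((-\infty,\cdot))=g+c\chi^+$ with $g\in L^2(\mathbb R)$, $c\in\mathbb R$; - $d\mu_{\mathrm{ac}}=u_x^2\,dx$ with $u_x$ the weak derivative of $u$. Here $\chi^\pm\in C^\infty(\mathbb R)$ satisfy $\chi^++\chi^-=1$, $0\le\chi^\pm\le1$, $\operatorname{supp}\chi^+\subset(-1,\infty)$, $\operatorname{supp}\chi^-\subset(-\infty,1)$. For $(u,\mu)\in\mathcal D$ write $F(x)=\mu((-\infty,x))=F_{\mathrm{ac}}(x)+F_{\mathrm{sing}}(x)$ with $F_{\mathrm{ac}}(x)=\mu_{\mathrm{ac}}((-\infty,x))$, $F_{\mathrm{sing}}(x)=\mu_{\mathrm{sing}}((-\infty,x))$, and $F_\infty=\mu(\mathbb R)$. **Conservative solution ($\alpha=0$).** For a pair $(u,\mu)$ put $$\bar y(\xi)=\sup\{x:\ x+\mu((-\infty,x))<\xi\},\qquad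 \bar U(\xi)=u(\bar y(\xi)),\qquad \bar V(\xi)=\xi-\bar y(\xi),$$ let $(y,U,V)(t)$, $t\ge0$, solve $$y_t=U,\qquad U_t=\tfrac12V-\tfrac14V_\infty(t),\qquad V(t,\xi)=\int_{-\infty}^{\xi}\bar V_\xi(\eta)\,d\eta,\qquad V_\infty(t)=\lim_{\xi\to\infty}V(t,\xi),$$ with $y(0)=\bar y$, $U(0)=\bar U$, and set $T_t((u,\mu))=(u(t),\mu(t))$, where $u(t,y(t,\xi))=U(t,\xi)$ for all $\xi$ and $\mu(t)=y(t)_\#(V_\xi(t)\,d\xi)$. **Projection.** For $\Delta x>0$ let $x_j=j\Delta x$, $f_j=f(x_j)$, $Df_{2j}=\frac{f_{2j+2}-f_{2j}}{2\Delta x}$, and $q_{2j}=\sqrt{DF_{\mathrm{ac},2j}-(Du_{2j})^2}$. Choose a sign $\sigma_j\in\{1,-1\}$ for each $j\in\mathbb Z$. Then $P_{\Delta x}((u,\mu))=(u_{\Delta x},\mu_{\Delta x})$, where $$u_{\Delta x}(x)=\begin{cases}u_{2j}+(Du_{2j}-\sigma_jq_{2j})(x-x_{2j}),& x_{2j}<x\le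 x_{2j+1},\\ u_{2j+2}+(Du_{2j}+\sigma_jq_{2j})(x-x_{2j+2}),& x_{2j+1}<x\le x_{2j+2},\end{cases}$$ and $\mu_{\Delta x}$ is the measure with $\mu_{\Delta x}((-\infty,x))=F_{\Delta x,\mathrm{ac}}(x)+F_{\Delta x,\mathrm{sing}}(x)$, where $F_{\Delta x,\mathrm{sing}}(x)=F_{\mathrm{sing},2j+2}$ for $x_{2j}<x\le x_{2j+2}$ and $$F_{\Delta x,\mathrm{ac}}(x)=\begin{cases}F_{\mathrm{ac},2j}+(Du_{2j}-\sigma_jq_{2j})^2(x-x_{2j}),& x_{2j}<x\le x_{2j+1},\\ \tfrac12(F_{\mathrm{ac},2j+2}+F_{\mathrm{ac},2j})-2\sigma_jq_{2j}Du_{2j}\Delta x+(Du_{2j}+\sigma_jq_{2j})^2(x-x_{2j+1}),& x_{2j+1}<x\le x_{2j+2}.\end{cases}$$ **Metric.** For finite nonnegative Borel measures $\lambda,\nu$ on $\mathbb R$, $$d_{\mathrm{BL}}(\lambda,\nu)=\sup\Big\{\int\psi\,d\lambda-\int\psi\,d\nu:\ \sup_x|\psi(x)|+\sup_{x\ne y}\tfrac{|\psi(x)-\psi(y)|}{|x-y|}\le1\Big\}.$$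 **Lemma.** Let $(\bar u,\bar\mu)\in\mathcal D$, $\bar F_\infty=\bar\mu(\mathbb R)$, $\Delta x>0$, $t\ge0$, and fix any choice of signs. Let $(u,\mu)(t)=T_t((\bar u,\bar\mu))$ and $(u_{\Delta x},\mu_{\Delta x})(t)=T_t(P_{\Delta x}((\bar u,\bar\mu)))$. Then $\mu(t)$ and $\mu_{\Delta x}(t)$ are finite measures and $$d_{\mathrm{BL}}(\mu(t),\mu_{\Delta x}(t))\le(1+2\sqrt2)\,t\,\bar F_\infty^{3/2}\Delta x^{1/2}+\Big(2+\tfrac12t^2+4e^{t/2}\Big)\bar F_\infty\,\Delta x.$$ -/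

import Mathlib

open MeasureTheory Set Filter Topology

namespace HunterSaxton

noncomputable section

/-! ### Function spaces on the real line -/

/-- `g` is the weak (distributional) derivative of `f` on `ℝ`. -/
structure HasWeakDeriv (f g : ℝ → ℝ) : Prop where
  locInt_fun : LocallyIntegrable f volume
  locInt_deriv : LocallyIntegrable g volume
  integral_eq : ∀ φ : ℝ → ℝ, ContDiff ℝ (⊤ : ℕ∞) φ → HasCompactSupport φ →
    ∫ x, f x * deriv φ x = - ∫ x, g x * φ x

/-- The Sobolev space `H¹(ℝ)`; elements are identified with their continuous representatives. -/
def InH1 (f : ℝ → ℝ) : Prop :=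
  Continuous f ∧ MemLp f 2 volume ∧ ∃ g : ℝ → ℝ, MemLp g 2 volume ∧ HasWeakDeriv f g

/-- A smooth partition of unity `(χ⁺, χ⁻)` subordinate to `ℝ = (-1, ∞) ∪ (-∞, 1)`. -/
structure IsCutoffPair (χp χm : ℝ → ℝ) : Prop where
  smooth_p : ContDiff ℝ (⊤ : ℕ∞) χp
  smooth_m : ContDiff ℝ (⊤ : ℕ∞) χm
  add_eq_one : ∀ x, χp x + χm x = 1
  nonneg_p : ∀ x, 0 ≤ χp x
  nonneg_m : ∀ x, 0 ≤ χm x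
  supp_p : tsupport χp ⊆ Ioi (-1)
  supp_m : tsupport χm ⊆ Iio 1

/-- `E₂ = R₂(H¹(ℝ) × ℝ²)`: functions `f + a χ⁺ + b χ⁻` with `f ∈ H¹(ℝ)`. The space does not
depend on the choice of the partition of unity. -/
def InE2 (u : ℝ → ℝ) : Prop :=
  ∃ χp χm : ℝ → ℝ, IsCutoffPair χp χm ∧
    ∃ (f : ℝ → ℝ) (a b : ℝ), InH1 f ∧ ∀ x, u x = f x + a * χp x + b * χm x

/-- `E₁⁰ = R₁(L²(ℝ) × ℝ)`: functions `f + a χ⁺` with `f ∈ L²(ℝ)`. -/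
def InE10 (F : ℝ → ℝ) : Prop :=
  ∃ χp χm : ℝ → ℝ, IsCutoffPair χp χm ∧
    ∃ (f : ℝ → ℝ) (a : ℝ), MemLp f 2 volume ∧ ∀ x, F x = f x + a * χp x

/-! ### Eulerian coordinates -/

/-- The absolutely continuous part of `μ` with respect to Lebesgue measure. -/
def acPart (μ : Measure ℝ) : Measure ℝ := volume.withDensity (μ.rnDeriv volume)

/-- The singular part of `μ` with respect to Lebesgue measure. -/
def singPart (μ : Measure ℝ) : Measure ℝ := μ.singularPart volume

/-- The (left continuous) cumulative function `F(x) = μ((-∞, x))`. -/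
def cumul (μ : Measure ℝ) (x : ℝ) : ℝ := μ.real (Iio x)

/-- The set `𝒟` of Eulerian coordinates `(u, μ)`. -/
structure InD (u : ℝ → ℝ) (μ : Measure ℝ) : Prop where
  u_mem : InE2 u
  finite : IsFiniteMeasure μ
  cumul_mem : InE10 (cumul μ)
  ac_eq : ∃ ux : ℝ → ℝ, HasWeakDeriv u ux ∧
    acPart μ = volume.withDensity (fun x => ENNReal.ofReal (ux x ^ 2))

/-- The Borel measure `μ` on `ℝ` with `μ((-∞, x)) = F(x)`, for `F` increasing, bounded, left
continuous and vanishing at `-∞` (see `cumul_measureOfCumul`). -/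
def measureOfCumul (F : ℝ → ℝ) : Measure ℝ :=
  open Classical in if h : Monotone F then h.stieltjesFunction.measure else 0

theorem cumul_measureOfCumul {F : ℝ → ℝ} (hF : Monotone F)
    (hl : ∀ x, ContinuousWithinAt F (Iio x) x) (h0 : Tendsto F atBot (𝓝 0)) (x : ℝ) :
    cumul (measureOfCumul F) x = F x := by
  have hb : Tendsto hF.stieltjesFunction atBot (𝓝 0) := by
    have h1 : Tendsto (fun x : ℝ => F (x + 1)) atBot (𝓝 0) :=
      h0.comp (tendsto_atBot_add_const_right _ _ tendsto_id)
    refine tendsto_of_tendsto_of_tendsto_of_le_of_le h0 h1 (fun y => hF.le_rightLim le_rfl)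
      (fun y => hF.rightLim_le (by simp))
  have hx : Function.leftLim hF.stieltjesFunction x = F x := by
    have h2 : Tendsto hF.stieltjesFunction (𝓝[<] x) (𝓝 (F x)) := by
      refine tendsto_of_tendsto_of_tendsto_of_le_of_le' (hl x) tendsto_const_nhds
        (Eventually.of_forall fun y => hF.le_rightLim le_rfl) ?_
      filter_upwards [self_mem_nhdsWithin] with y hy
      exact hF.rightLim_le hy
    exact leftLim_eq_of_tendsto h2
  have hpos : 0 ≤ F x := hF.le_of_tendsto h0 x
  rw [cumul, measureOfCumul, dif_pos hF, Measure.real, StieltjesFunction.measure_Iio _ hb, hx,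
    sub_zero, ENNReal.toReal_ofReal hpos]

/-! ### The projection onto the mesh `x_j = j Δx` -/

/-- The index `j` with `x_{2j} < x ≤ x_{2j+2}`. -/
def cell (Δx x : ℝ) : ℤ := ⌈x / (2 * Δx)⌉ - 1

theorem cell_spec {Δx : ℝ} (h : 0 < Δx) (x : ℝ) :
    (2 * cell Δx x : ℤ) * Δx < x ∧ x ≤ (2 * cell Δx x + 2 : ℤ) * Δx := by
  have h2 : 0 < 2 * Δx := by linarith
  have h3 := Int.ceil_lt_add_one (x / (2 * Δx))
  have h4 := Int.le_ceil (x / (2 * Δx))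
  rw [div_le_iff₀ h2] at h4
  have h5 : (⌈x / (2 * Δx)⌉ : ℝ) - 1 < x / (2 * Δx) := by linarith
  rw [lt_div_iff₀ h2] at h5
  simp only [cell]
  push_cast
  constructor <;> nlinarith

/-- The grid value `f_k = f(x_k) = f(k Δx)`. -/
def gridVal (Δx : ℝ) (f : ℝ → ℝ) (k : ℤ) : ℝ := f (k * Δx)

/-- The difference quotient `D f_{2j} = (f_{2j+2} - f_{2j}) / (2 Δx)`. -/
def diffQuot (Δx : ℝ) (f : ℝ → ℝ) (j : ℤ) : ℝ :=
  (gridVal Δx f (2 * j + 2) - gridVal Δx f (2 * j)) / (2 * Δx)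

/-- `q_{2j} = √(D F_{ac,2j} - (D u_{2j})²)`. -/
def projQ (Δx : ℝ) (u : ℝ → ℝ) (μ : Measure ℝ) (j : ℤ) : ℝ :=
  √(diffQuot Δx (cumul (acPart μ)) j - diffQuot Δx u j ^ 2)

/-- The projected wave profile `u_{Δx}`. The sign `σ j = ±1` is the choice made on the cell
`(x_{2j}, x_{2j+2}]`; `σ j = 1` corresponds to the upper signs. -/
def projU (σ : ℤ → ℤˣ) (Δx : ℝ) (u : ℝ → ℝ) (μ : Measure ℝ) (x : ℝ) : ℝ :=
  let j := cell Δx x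
  let s : ℝ := ((σ j : ℤ) : ℝ)
  let Du := diffQuot Δx u j
  let q := projQ Δx u μ j
  if x ≤ ((2 * j + 1 : ℤ) : ℝ) * Δx then
    gridVal Δx u (2 * j) + (Du - s * q) * (x - ((2 * j : ℤ) : ℝ) * Δx)
  else
    gridVal Δx u (2 * j + 2) + (Du + s * q) * (x - ((2 * j + 2 : ℤ) : ℝ) * Δx)

/-- The absolutely continuous part `F_{Δx,ac}` of the projected cumulative energy. -/
def projFac (σ : ℤ → ℤˣ) (Δx : ℝ) (u : ℝ → ℝ) (μ : Measure ℝ) (x : ℝ) : ℝ :=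
  let j := cell Δx x
  let s : ℝ := ((σ j : ℤ) : ℝ)
  let Du := diffQuot Δx u j
  let q := projQ Δx u μ j
  let Fac := gridVal Δx (cumul (acPart μ))
  if x ≤ ((2 * j + 1 : ℤ) : ℝ) * Δx then
    Fac (2 * j) + (Du - s * q) ^ 2 * (x - ((2 * j : ℤ) : ℝ) * Δx)
  else
    (1 / 2) * (Fac (2 * j + 2) + Fac (2 * j)) - s * (2 * q * Du * Δx)
      + (Du + s * q) ^ 2 * (x - ((2 * j + 1 : ℤ) : ℝ) * Δx)

/-- The singular part `F_{Δx,sing}` of the projected cumulative energy. -/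
def projFsing (Δx : ℝ) (μ : Measure ℝ) (x : ℝ) : ℝ :=
  gridVal Δx (cumul (singPart μ)) (2 * cell Δx x + 2)

/-- The projected cumulative energy `F_{Δx}`. -/
def projF (σ : ℤ → ℤˣ) (Δx : ℝ) (u : ℝ → ℝ) (μ : Measure ℝ) (x : ℝ) : ℝ :=
  projFac σ Δx u μ x + projFsing Δx μ x

/-- The projection operator `P_{Δx}`, on pairs `(u, μ)`. -/
def proj (σ : ℤ → ℤˣ) (Δx : ℝ) (z : (ℝ → ℝ) × Measure ℝ) : (ℝ → ℝ) × Measure ℝ :=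
  (projU σ Δx z.1 z.2, measureOfCumul (projF σ Δx z.1 z.2))

/-! ### Lagrangian coordinates and the solution operator -/

/-- A triplet `(y, U, V)` of Lagrangian coordinates. -/
structure Lagr where
  y : ℝ → ℝ
  U : ℝ → ℝ
  V : ℝ → ℝ

/-- The map `L` from Eulerian to Lagrangian coordinates. -/
def mapL (z : (ℝ → ℝ) × Measure ℝ) : Lagr :=
  let y : ℝ → ℝ := fun ξ => sSup {x : ℝ | x + cumul z.2 x < ξ}
  { y := y, U := fun ξ => z.1 (y ξ), V := fun ξ => ξ - y ξ }

/-- The wave breaking function `τ : ℝ → [0, ∞]`. -/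
def waveBreak (X : Lagr) (ξ : ℝ) : ENNReal :=
  open Classical in
  if deriv X.U ξ = 0 ∧ deriv X.y ξ = 0 then 0
  else if deriv X.U ξ < 0 then ENNReal.ofReal (-2 * (deriv X.y ξ / deriv X.U ξ))
  else ⊤

/-- `V(t, ξ) = ∫_{-∞}^ξ (1 - α χ_{{t ≥ τ > 0}}(η)) V̄_ξ(η) dη`. -/
def lagrV (α : ℝ) (X : Lagr) (t ξ : ℝ) : ℝ :=
  ∫ η in Iic ξ,
    (1 - α * indicator {ω : ℝ | waveBreak X ω ≤ ENNReal.ofReal t ∧ 0 < waveBreak X ω} 1 η)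
      * deriv X.V η

/-- The right asymptote `V_∞(t) = lim_{ξ → ∞} V(t, ξ)`. -/
def lagrVinf (α : ℝ) (X : Lagr) (t : ℝ) : ℝ := limUnder atTop (fun ξ => lagrV α X t ξ)

/-- `U(t, ξ)`, from `U_t = V / 2 - V_∞ / 4` (integrated in time) and `U(0, ·) = Ū`. -/
def lagrU (α : ℝ) (X : Lagr) (t ξ : ℝ) : ℝ :=
  X.U ξ + ∫ s in (0 : ℝ)..t, ((1 / 2) * lagrV α X s ξ - (1 / 4) * lagrVinf α X s)

/-- `y(t, ξ)`, from `y_t = U` (integrated in time) and `y(0, ·) = ȳ`. -/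
def lagrY (α : ℝ) (X : Lagr) (t ξ : ℝ) : ℝ :=
  X.y ξ + ∫ s in (0 : ℝ)..t, lagrU α X s ξ

/-- The Lagrangian solution operator `S_t`. Since `V(t, ·)` is given explicitly by the initial
data, the Lagrangian system is solved by integrating in time twice. -/
def solS (α t : ℝ) (X : Lagr) : Lagr :=
  { y := lagrY α X t, U := lagrU α X t, V := lagrV α X t }

/-- The map `M` from Lagrangian to Eulerian coordinates: `u(x) = U(ξ)` for any `ξ` with
`x = y(ξ)`, and `μ` is the pushforward of `V_ξ dξ` under `y`. -/
def mapM (X : Lagr) : (ℝ → ℝ) × Measure ℝ :=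
  (fun x => X.U (Function.invFun X.y x),
    Measure.map X.y (volume.withDensity fun ξ => ENNReal.ofReal (deriv X.V ξ)))

/-- The solution operator `T_t = M ∘ S_t ∘ L` for `α`-dissipative solutions. -/
def solT (α t : ℝ) (z : (ℝ → ℝ) × Measure ℝ) : (ℝ → ℝ) × Measure ℝ :=
  mapM (solS α t (mapL z))

/-! ### The bounded Lipschitz metric -/

/-- `‖ψ‖_BL = sup |ψ| + sup_{x ≠ y} |ψ x - ψ y| / |x - y|`, with value `∞` exactly when `ψ` is
not a bounded Lipschitz function. -/
def normBL (ψ : ℝ → ℝ) : ENNReal :=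
  (⨆ x : ℝ, ENNReal.ofReal |ψ x|) +
    ⨆ (x : ℝ) (y : ℝ) (_ : x ≠ y), ENNReal.ofReal (|ψ x - ψ y| / |x - y|)

/-- The bounded Lipschitz (Fortet--Mourier) metric between finite Borel measures. The supremum is
taken in the extended reals. -/
def dBL (lam nu : Measure ℝ) : EReal :=
  ⨆ (ψ : ℝ → ℝ) (_ : normBL ψ ≤ 1), (((∫ x, ψ x ∂lam) - ∫ x, ψ x ∂nu : ℝ) : EReal)

end

end HunterSaxton

namespace HunterSaxton

/-! ### Weak derivatives of continuous functions -/

/-! For `α = 0` the Lagrangian energy `V` does not depend on time. Parametrising by the energy level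
`v` instead of `ξ`, the evolved measure is the image of Lebesgue measure on `(0, μ(ℝ))` under `v ↦ P
v + t u(P v) + t²/2 (v/2 - μ(ℝ)/4)`, with `P` a generalised inverse of the cumulative energy
(`exists_quantile_solT`).

The projection preserves the cumulative energy at the even mesh points and the total mass
(`projF_grid`, `real_univ_proj`). Both solutions are therefore images of the same measure, and for
almost every `v` the points `P v` and `Q v` lie in one common cell. The `t²` terms cancel. The
points differ by at most `2Δx`, and by Cauchy–Schwarz each profile differs from the common value
`u_{2j}` by at most `√(2Δx μ(ℝ))` (`abs_sub_gridVal_le`, `abs_projU_sub_gridVal_le`). Integrating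
against a 1-Lipschitz test function (`dBL_map_le`) gives the bound `μ(ℝ)(2Δx + 2t√(2Δx μ(ℝ)))`,
which is smaller than the claimed one. -/

/-- The smooth step `x ↦ S((x - a)/ε)`, with derivative concentrated on `[a, a + ε]`. -/
noncomputable def smoothStep (ε a x : ℝ) : ℝ := Real.smoothTransition ((x - a) / ε)

theorem contDiff_smoothStep (ε a : ℝ) : ContDiff ℝ (⊤ : ℕ∞) (smoothStep ε a) := by
  unfold smoothStep
  exact Real.smoothTransition.contDiff.comp (by fun_prop)

theorem smoothStep_of_le {ε a x : ℝ} (hε : 0 < ε) (hx : x ≤ a) : smoothStep ε a x = 0 :=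
  Real.smoothTransition.zero_of_nonpos (div_nonpos_of_nonpos_of_nonneg (by linarith) hε.le)

theorem smoothStep_of_ge {ε a x : ℝ} (hε : 0 < ε) (hx : a + ε ≤ x) : smoothStep ε a x = 1 :=
  Real.smoothTransition.one_of_one_le (by rw [le_div_iff₀ hε]; linarith)

theorem deriv_smoothTransition_eq_zero {s : ℝ} (hs : s ∉ Icc (0 : ℝ) 1) :
    deriv Real.smoothTransition s = 0 := by
  rw [mem_Icc, not_and_or, not_le, not_le] at hs
  rcases hs with hs | hs
  · have : Real.smoothTransition =ᶠ[𝓝 s] fun _ => (0 : ℝ) := by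
      filter_upwards [Iio_mem_nhds hs] with x hx
      exact Real.smoothTransition.zero_of_nonpos (le_of_lt hx)
    rw [this.deriv_eq]; simp
  · have : Real.smoothTransition =ᶠ[𝓝 s] fun _ => (1 : ℝ) := by
      filter_upwards [Ioi_mem_nhds hs] with x hx
      exact Real.smoothTransition.one_of_one_le (le_of_lt hx)
    rw [this.deriv_eq]; simp

theorem deriv_smoothStep (ε a x : ℝ) :
    deriv (smoothStep ε a) x = deriv Real.smoothTransition ((x - a) / ε) * ε⁻¹ := by
  have h1 : HasDerivAt (fun x : ℝ => (x - a) / ε) (ε⁻¹) x := by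
    have := ((hasDerivAt_id x).sub_const a).div_const ε
    simpa using this
  have h2 : HasDerivAt Real.smoothTransition (deriv Real.smoothTransition ((x - a) / ε))
      ((x - a) / ε) :=
    ((Real.smoothTransition.contDiff (n := 1)).differentiable (by simp) _).hasDerivAt
  exact (h2.comp x h1).deriv

theorem continuous_deriv_smoothTransition : Continuous (deriv Real.smoothTransition) :=
  (Real.smoothTransition.contDiff (n := 1)).continuous_deriv le_rfl

theorem hasCompactSupport_deriv_smoothStep {ε : ℝ} (hε : 0 < ε) (a : ℝ) :
    HasCompactSupport (deriv (smoothStep ε a)) := by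
  refine HasCompactSupport.intro (K := Icc a (a + ε)) isCompact_Icc fun x hx => ?_
  rw [deriv_smoothStep, deriv_smoothTransition_eq_zero, zero_mul]
  refine fun h => hx ⟨?_, ?_⟩
  · have := h.1
    rw [le_div_iff₀ hε] at this; linarith
  · have := h.2
    rw [div_le_iff₀ hε] at this; linarith

theorem integral_mul_deriv_smoothStep (u : ℝ → ℝ) {ε : ℝ} (hε : 0 < ε) (a : ℝ) :
    ∫ x, u x * deriv (smoothStep ε a) x
      = ∫ s in (0 : ℝ)..1, u (a + ε * s) * deriv Real.smoothTransition s := by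
  have h1 : ∫ x, u x * deriv (smoothStep ε a) x
      = ∫ s, u (a + ε * s) * deriv Real.smoothTransition s := by
    have e1 := integral_add_right_eq_self (μ := volume)
      (fun x => u x * deriv (smoothStep ε a) x) a
    have e2 := Measure.integral_comp_mul_left
      (fun x => u (x + a) * deriv (smoothStep ε a) (x + a)) ε
    rw [← e1]
    have e3 : (fun s => u (a + ε * s) * deriv Real.smoothTransition s)
        = fun s => ε * (u (ε * s + a) * deriv (smoothStep ε a) (ε * s + a)) := by
      funext s
      rw [deriv_smoothStep, show (ε * s + a - a) / ε = s by field_simp; ring, add_comm (ε * s)]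
      field_simp
    rw [e3, integral_const_mul, e2, smul_eq_mul, abs_of_pos (inv_pos.2 hε), ← mul_assoc,
      mul_inv_cancel₀ hε.ne', one_mul]
  rw [h1, intervalIntegral.integral_of_le zero_le_one, ← integral_Icc_eq_integral_Ioc]
  refine (setIntegral_eq_integral_of_forall_compl_eq_zero fun s hs => ?_).symm
  rw [deriv_smoothTransition_eq_zero hs, mul_zero]

/-- The derivatives of the steps are an approximate identity. After rescaling to the fixed interval
`[0, 1]` the integral is continuous in `ε` up to `ε = 0`, where `∫ S' = 1`. -/
theorem tendsto_integral_mul_deriv_smoothStep {u : ℝ → ℝ} (hu : Continuous u) (a : ℝ) :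
    Tendsto (fun ε => ∫ x, u x * deriv (smoothStep ε a) x) (𝓝[>] 0) (𝓝 (u a)) := by
  have hc : Continuous fun ε : ℝ =>
      ∫ s in (0 : ℝ)..1, u (a + ε * s) * deriv Real.smoothTransition s := by
    refine intervalIntegral.continuous_parametric_intervalIntegral_of_continuous' ?_ 0 1
    have := continuous_deriv_smoothTransition
    fun_prop
  have h0 : ∫ s in (0 : ℝ)..1, u (a + 0 * s) * deriv Real.smoothTransition s = u a := by
    simp only [zero_mul, add_zero]
    rw [intervalIntegral.integral_const_mul, intervalIntegral.integral_deriv_eq_sub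
      (fun x _ => (Real.smoothTransition.contDiff (n := 1)).differentiable (by simp) x)
      (continuous_deriv_smoothTransition.intervalIntegrable _ _)]
    simp
  have h1 := hc.tendsto 0
  rw [h0] at h1
  refine (h1.mono_left nhdsWithin_le_nhds).congr' ?_
  filter_upwards [self_mem_nhdsWithin] with ε hε
  exact (integral_mul_deriv_smoothStep u hε a).symm

/-- Test the weak derivative with a difference of smooth steps at `a` and `b`, which tends to the
indicator of `(a, b]`, and let `ε → 0`. -/
theorem HasWeakDeriv.integral_eq_sub {u g : ℝ → ℝ} (h : HasWeakDeriv u g) (hu : Continuous u)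
    {a b : ℝ} (hab : a ≤ b) : ∫ x in a..b, g x = u b - u a := by
  have hL : Tendsto (fun ε => ∫ x, u x * deriv (fun x => smoothStep ε a x - smoothStep ε b x) x)
      (𝓝[>] 0) (𝓝 (u a - u b)) := by
    refine ((tendsto_integral_mul_deriv_smoothStep hu a).sub
      (tendsto_integral_mul_deriv_smoothStep hu b)).congr' ?_
    filter_upwards [self_mem_nhdsWithin] with ε hε
    have hi : ∀ c, Integrable (fun x => u x * deriv (smoothStep ε c) x) := fun c =>
      (hu.mul ((contDiff_smoothStep ε c).continuous_deriv (by simp))).integrable_of_hasCompactSupport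
        (hasCompactSupport_deriv_smoothStep hε c).mul_left
    rw [← integral_sub (hi a) (hi b)]
    congr 1
    funext x
    rw [deriv_fun_sub ((contDiff_smoothStep ε a).differentiable (by simp) x)
      ((contDiff_smoothStep ε b).differentiable (by simp) x)]
    ring
  have hR : Tendsto (fun ε => ∫ x, g x * (smoothStep ε a x - smoothStep ε b x))
      (𝓝[>] 0) (𝓝 (∫ x, (Ioc a b).indicator g x)) := by
    refine tendsto_integral_filter_of_dominated_convergence
      (fun x => (Icc a (b + 1)).indicator (fun x => ‖g x‖) x) ?_ ?_ ?_ ?_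
    · refine Eventually.of_forall fun ε => h.locInt_deriv.aestronglyMeasurable.mul ?_
      exact ((contDiff_smoothStep ε a).continuous.sub
        (contDiff_smoothStep ε b).continuous).aestronglyMeasurable
    -- Restricting to `ε < 1` keeps all test functions supported in the fixed interval `[a, b + 1]`.
    · filter_upwards [self_mem_nhdsWithin, mem_nhdsWithin_of_mem_nhds (Iio_mem_nhds one_pos)]
        with ε hε hε1
      refine Eventually.of_forall fun x => ?_
      by_cases hx : x ∈ Icc a (b + 1)
      · rw [indicator_of_mem hx, norm_mul]
        refine mul_le_of_le_one_right (norm_nonneg _) ?_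
        rw [Real.norm_eq_abs, abs_le]
        have h1 := Real.smoothTransition.nonneg ((x - a) / ε)
        have h2 := Real.smoothTransition.le_one ((x - a) / ε)
        have h3 := Real.smoothTransition.nonneg ((x - b) / ε)
        have h4 := Real.smoothTransition.le_one ((x - b) / ε)
        simp only [smoothStep]
        constructor <;> linarith
      · rw [indicator_of_notMem hx]
        rw [mem_Icc, not_and_or, not_le, not_le] at hx
        have hε' : ε < 1 := hε1
        rcases hx with hx | hx
        · rw [smoothStep_of_le hε hx.le, smoothStep_of_le hε (by linarith)]; simp
        · rw [smoothStep_of_ge hε (by linarith), smoothStep_of_ge hε (by linarith)]; simp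
    · rw [integrable_indicator_iff measurableSet_Icc]
      exact (h.locInt_deriv.integrableOn_isCompact isCompact_Icc).norm
    · have hstep : ∀ c x : ℝ, Tendsto (fun ε => smoothStep ε c x) (𝓝[>] 0)
          (𝓝 ((Ioi c).indicator 1 x)) := by
        intro c x
        refine tendsto_const_nhds.congr' ?_
        by_cases hx : c < x
        · filter_upwards [self_mem_nhdsWithin,
            mem_nhdsWithin_of_mem_nhds (Iio_mem_nhds (sub_pos.2 hx))] with ε hε hε1
          have hε' : ε < x - c := hε1
          rw [smoothStep_of_ge hε (by linarith), indicator_of_mem (mem_Ioi.2 hx)]; rfl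
        · filter_upwards [self_mem_nhdsWithin] with ε hε
          rw [smoothStep_of_le hε (not_lt.1 hx), indicator_of_notMem (by simpa using hx)]
      refine Eventually.of_forall fun x => ?_
      have := ((hstep a x).sub (hstep b x)).const_mul (g x)
      convert this using 2
      by_cases h1 : a < x <;> by_cases h2 : b < x
      · simp [indicator, h1, h2]
      · simp [indicator, h1, h2, not_lt.1 h2]
      · linarith
      · simp [indicator, h1, h2]
  rw [integral_indicator measurableSet_Ioc, ← intervalIntegral.integral_of_le hab] at hR
  have key : ∀ᶠ ε in 𝓝[>] (0 : ℝ),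
      ∫ x, u x * deriv (fun x => smoothStep ε a x - smoothStep ε b x) x
        = - ∫ x, g x * (smoothStep ε a x - smoothStep ε b x) := by
    filter_upwards [self_mem_nhdsWithin] with ε hε
    refine h.integral_eq _ ((contDiff_smoothStep ε a).sub (contDiff_smoothStep ε b)) ?_
    have hε' : 0 < ε := hε
    refine HasCompactSupport.intro (K := Icc a (b + ε)) isCompact_Icc fun x hx => ?_
    rw [mem_Icc, not_and_or, not_le, not_le] at hx
    rcases hx with hx | hx
    · rw [smoothStep_of_le hε hx.le, smoothStep_of_le hε (by linarith)]; simp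
    · rw [smoothStep_of_ge hε (by linarith), smoothStep_of_ge hε (by linarith)]; simp
  have := tendsto_nhds_unique (hL.congr' key) hR.neg
  linarith

/-- Cauchy–Schwarz against the constant 1, from nonnegativity of the integral of `(g - c)²` with `c`
the mean of `g`. -/
theorem sq_intervalIntegral_le {g : ℝ → ℝ} {a b : ℝ} (hab : a ≤ b)
    (hg : IntervalIntegrable g volume a b)
    (hg2 : IntervalIntegrable (fun x => g x ^ 2) volume a b) :
    (∫ x in a..b, g x) ^ 2 ≤ (b - a) * ∫ x in a..b, g x ^ 2 := by
  rcases hab.eq_or_lt with rfl | hlt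
  · simp
  set S := ∫ x in a..b, g x
  set I := ∫ x in a..b, g x ^ 2
  have hL : 0 < b - a := sub_pos.2 hlt
  set c := S / (b - a)
  have h0 : 0 ≤ ∫ x in a..b, (g x - c) ^ 2 :=
    intervalIntegral.integral_nonneg hab fun x _ => sq_nonneg _
  have h1 : ∫ x in a..b, (g x - c) ^ 2 = I - 2 * c * S + (b - a) * c ^ 2 := by
    have : (fun x => (g x - c) ^ 2) = fun x => (g x ^ 2 - 2 * c * g x) + c ^ 2 := by
      funext x; ring
    rw [this, intervalIntegral.integral_add (hg2.sub (hg.const_mul _)) (by simp),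
      intervalIntegral.integral_sub hg2 (hg.const_mul _), intervalIntegral.integral_const_mul,
      intervalIntegral.integral_const, smul_eq_mul]
  rw [h1] at h0
  have h2 : c * (b - a) = S := div_mul_cancel₀ _ hL.ne'
  have h3 := mul_nonneg hL.le h0
  have h4 : (b - a) * (I - 2 * c * S + (b - a) * c ^ 2) = (b - a) * I - S ^ 2 := by
    rw [← h2]; ring
  linarith

theorem InE2.continuous {u : ℝ → ℝ} (h : InE2 u) : Continuous u := by
  obtain ⟨χp, χm, hχ, f, a, b, hf, hu⟩ := h
  rw [funext hu]
  have := hf.1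
  have := hχ.smooth_p.continuous
  have := hχ.smooth_m.continuous
  fun_prop

/-! ### Cumulative functions and the Lebesgue decomposition -/

theorem acPart_le (μ : Measure ℝ) : acPart μ ≤ μ := Measure.withDensity_rnDeriv_le μ volume

theorem acPart_add_singPart (μ : Measure ℝ) [IsFiniteMeasure μ] : acPart μ + singPart μ = μ := by
  rw [add_comm]
  exact (Measure.haveLebesgueDecomposition_add μ volume).symm

theorem cumul_mono (μ : Measure ℝ) [IsFiniteMeasure μ] : Monotone (cumul μ) :=
  fun _ _ h => measureReal_mono (Iio_subset_Iio h)

theorem cumul_nonneg (μ : Measure ℝ) (x : ℝ) : 0 ≤ cumul μ x := measureReal_nonneg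

theorem cumul_le (μ : Measure ℝ) [IsFiniteMeasure μ] (x : ℝ) : cumul μ x ≤ μ.real univ :=
  measureReal_mono (subset_univ _)

theorem cumul_acPart_add_singPart (μ : Measure ℝ) [IsFiniteMeasure μ] (x : ℝ) :
    cumul (acPart μ) x + cumul (singPart μ) x = cumul μ x := by
  have : IsFiniteMeasure (acPart μ) := isFiniteMeasure_of_le μ (acPart_le μ)
  have : IsFiniteMeasure (singPart μ) := by unfold singPart; infer_instance
  conv_rhs => rw [← acPart_add_singPart μ]
  simp [cumul, measureReal_add_apply]

/-- The Hölder estimate for the wave profile. -/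
theorem InD.sq_sub_le {u : ℝ → ℝ} {μ : Measure ℝ} (h : InD u μ) {a b : ℝ} (hab : a ≤ b) :
    (u b - u a) ^ 2 ≤ (b - a) * (cumul (acPart μ) b - cumul (acPart μ) a) := by
  have := h.finite
  have : IsFiniteMeasure (acPart μ) := isFiniteMeasure_of_le μ (acPart_le μ)
  obtain ⟨g, hg, hac⟩ := h.ac_eq
  have hgm : AEStronglyMeasurable g volume := hg.locInt_deriv.aestronglyMeasurable
  have hI : Integrable (fun x => g x ^ 2) volume := by
    refine ⟨hgm.pow 2, ?_⟩
    rw [hasFiniteIntegral_iff_ofReal (Eventually.of_forall fun x => sq_nonneg _)]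
    have := measure_lt_top (acPart μ) univ
    rwa [hac, withDensity_apply _ MeasurableSet.univ, Measure.restrict_univ] at this
  have hF : cumul (acPart μ) b - cumul (acPart μ) a = ∫ x in a..b, g x ^ 2 := by
    have e1 : cumul (acPart μ) b - cumul (acPart μ) a = (acPart μ).real (Ico a b) := by
      rw [cumul, cumul, ← measureReal_sdiff (Iio_subset_Iio hab) measurableSet_Iio,
        show Iio b \ Iio a = Ico a b by ext x; simp]
    rw [e1, hac, Measure.real, withDensity_apply _ measurableSet_Ico,
      ← ofReal_integral_eq_lintegral_ofReal hI.integrableOn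
        (Eventually.of_forall fun x => sq_nonneg _),
      ENNReal.toReal_ofReal (integral_nonneg fun x => sq_nonneg _),
      intervalIntegral.integral_of_le hab, integral_Ico_eq_integral_Ioc]
  rw [hF, ← hg.integral_eq_sub h.u_mem.continuous hab]
  exact sq_intervalIntegral_le hab (hg.locInt_deriv.integrableOn_isCompact isCompact_uIcc).intervalIntegrable
    hI.intervalIntegrable

end HunterSaxton

namespace HunterSaxton

/-! ### The conservative flow in quantile coordinates -/

section Lagrangian

variable (u : ℝ → ℝ) (μ : Measure ℝ) [IsFiniteMeasure μ]

theorem tendsto_cumul_atBot : Tendsto (cumul μ) atBot (𝓝 0) := by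
  have h : Tendsto (fun x => μ (Iio x)) atBot (𝓝 (μ (⋂ x : ℝ, Iio x))) :=
    tendsto_measure_iInter_atBot (fun x => measurableSet_Iio.nullMeasurableSet)
      (fun _ _ h => Iio_subset_Iio h) ⟨0, measure_ne_top _ _⟩
  have he : ⋂ x : ℝ, Iio x = ∅ :=
    eq_empty_of_forall_notMem fun x hx => lt_irrefl x (mem_iInter.1 hx x)
  rw [he, measure_empty] at h
  exact (ENNReal.tendsto_toReal ENNReal.zero_ne_top).comp h

theorem tendsto_cumul_atTop : Tendsto (cumul μ) atTop (𝓝 (μ.real univ)) := by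
  have h : Tendsto (fun x => μ (Iio x)) atTop (𝓝 (μ (⋃ x : ℝ, Iio x))) :=
    tendsto_measure_iUnion_atTop (fun _ _ h => Iio_subset_Iio h)
  rw [iUnion_Iio] at h
  exact (ENNReal.tendsto_toReal (measure_ne_top _ _)).comp h

theorem isLUB_mapL_y (ξ : ℝ) : IsLUB {x : ℝ | x + cumul μ x < ξ} ((mapL (u, μ)).y ξ) := by
  refine isLUB_csSup ⟨ξ - μ.real univ - 1, ?_⟩ ⟨ξ, fun x hx => ?_⟩
  · have := cumul_le μ (ξ - μ.real univ - 1)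
    simp only [mem_ofPred_eq]; linarith
  · have := cumul_nonneg μ x
    simp only [mem_ofPred_eq] at hx; linarith

/-- Together with `le_cumul_of_mapL_y_lt` this places the level `V̄(ξ)` between the one-sided limits
of the cumulative energy at `ȳ(ξ)`. At an atom `V̄` runs through the whole jump, so only points
strictly to one side are compared. -/
theorem cumul_le_of_lt_mapL_y {ξ x : ℝ} (h : x < (mapL (u, μ)).y ξ) :
    cumul μ x ≤ (mapL (u, μ)).V ξ := by
  have key : ∀ z, x < z → z < (mapL (u, μ)).y ξ → z ≤ ξ - cumul μ x := by
    intro z hxz hz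
    obtain ⟨w, hw, hzw⟩ := (lt_isLUB_iff (isLUB_mapL_y u μ ξ)).1 hz
    have := cumul_mono μ (hxz.le.trans hzw.le)
    simp only [mem_ofPred_eq] at hw; linarith
  have : (mapL (u, μ)).y ξ ≤ ξ - cumul μ x := by
    refine le_of_forall_lt_imp_le_of_dense fun z hz => ?_
    obtain ⟨w, hw, hw'⟩ := exists_between (max_lt h hz)
    exact ((le_max_right x z).trans hw.le).trans (key w ((le_max_left x z).trans_lt hw) hw')
  change cumul μ x ≤ ξ - (mapL (u, μ)).y ξ
  linarith

theorem le_cumul_of_mapL_y_lt {ξ x : ℝ} (h : (mapL (u, μ)).y ξ < x) :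
    (mapL (u, μ)).V ξ ≤ cumul μ x := by
  have key : ∀ z, (mapL (u, μ)).y ξ < z → z ≤ x → ξ - cumul μ x ≤ z := by
    intro z hz hzx
    by_contra hlt
    have := cumul_mono μ hzx
    have hz' : z ∈ {x : ℝ | x + cumul μ x < ξ} := by
      simp only [mem_ofPred_eq]; linarith
    exact absurd ((isLUB_mapL_y u μ ξ).1 hz') (not_le.2 hz)
  have : ξ - cumul μ x ≤ (mapL (u, μ)).y ξ := by
    refine le_of_forall_gt_imp_ge_of_dense fun z hz => ?_
    exact (key (min x z) (lt_min h hz) (min_le_left _ _)).trans (min_le_right _ _)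
  change ξ - (mapL (u, μ)).y ξ ≤ cumul μ x
  linarith

theorem mapL_V_nonneg (ξ : ℝ) : 0 ≤ (mapL (u, μ)).V ξ :=
  (cumul_nonneg μ _).trans (cumul_le_of_lt_mapL_y u μ (sub_one_lt ((mapL (u, μ)).y ξ)))

theorem mapL_V_le (ξ : ℝ) : (mapL (u, μ)).V ξ ≤ μ.real univ :=
  (le_cumul_of_mapL_y_lt u μ (lt_add_one ((mapL (u, μ)).y ξ))).trans (cumul_le μ _)

theorem mapL_y_mono : Monotone (mapL (u, μ)).y := fun ξ ζ h =>
  (isLUB_mapL_y u μ ξ).2 fun _ hx => (isLUB_mapL_y u μ ζ).1 (lt_of_lt_of_le hx h)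

theorem mapL_V_mono : Monotone (mapL (u, μ)).V := by
  intro ξ ζ h
  change ξ - (mapL (u, μ)).y ξ ≤ ζ - (mapL (u, μ)).y ζ
  suffices (mapL (u, μ)).y ζ ≤ (mapL (u, μ)).y ξ + (ζ - ξ) by linarith
  refine (isLUB_mapL_y u μ ζ).2 fun x hx => ?_
  simp only [mem_ofPred_eq] at hx
  have hm := cumul_mono μ (show x - (ζ - ξ) ≤ x by linarith)
  have : x - (ζ - ξ) ≤ (mapL (u, μ)).y ξ :=
    (isLUB_mapL_y u μ ξ).1 (by simp only [mem_ofPred_eq]; linarith)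
  linarith

/-- The identity is the sum of the two increasing functions `ȳ` and `V̄`, so neither can grow faster
than it. -/
theorem mapL_V_lipschitz : LipschitzWith 1 (mapL (u, μ)).V := by
  refine LipschitzWith.of_le_add fun ξ ζ => ?_
  rcases le_total ξ ζ with h | h
  · exact (mapL_V_mono u μ h).trans (le_add_of_nonneg_right dist_nonneg)
  · have := mapL_y_mono u μ h
    rw [Real.dist_eq, abs_of_nonneg (by linarith)]
    change ξ - (mapL (u, μ)).y ξ ≤ ζ - (mapL (u, μ)).y ζ + (ξ - ζ)
    linarith

theorem tendsto_mapL_V_atBot : Tendsto (mapL (u, μ)).V atBot (𝓝 0) := by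
  have h : Tendsto (fun ξ : ℝ => cumul μ (ξ + 1)) atBot (𝓝 0) :=
    (tendsto_cumul_atBot μ).comp (tendsto_atBot_add_const_right _ _ tendsto_id)
  refine tendsto_of_tendsto_of_tendsto_of_le_of_le tendsto_const_nhds h (mapL_V_nonneg u μ)
    fun ξ => le_cumul_of_mapL_y_lt u μ ?_
  have : 0 ≤ ξ - (mapL (u, μ)).y ξ := mapL_V_nonneg u μ ξ
  linarith

theorem tendsto_mapL_V_atTop : Tendsto (mapL (u, μ)).V atTop (𝓝 (μ.real univ)) := by
  have h : Tendsto (fun ξ : ℝ => cumul μ (ξ + (-μ.real univ - 1))) atTop (𝓝 (μ.real univ)) :=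
    (tendsto_cumul_atTop μ).comp (tendsto_atTop_add_const_right _ _ tendsto_id)
  refine tendsto_of_tendsto_of_tendsto_of_le_of_le h tendsto_const_nhds
    (fun ξ => cumul_le_of_lt_mapL_y u μ ?_) (mapL_V_le u μ)
  have : ξ - (mapL (u, μ)).y ξ ≤ μ.real univ := mapL_V_le u μ ξ
  linarith

theorem deriv_mapL_V_nonneg (ξ : ℝ) : 0 ≤ deriv (mapL (u, μ)).V ξ :=
  (mapL_V_mono u μ).deriv_nonneg

/-- Lipschitz functions are absolutely continuous, so `V̄` is recovered from its a.e. derivative. -/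
theorem intervalIntegral_deriv_mapL_V (a b : ℝ) :
    IntervalIntegrable (deriv (mapL (u, μ)).V) volume a b ∧
    ∫ η in a..b, deriv (mapL (u, μ)).V η = (mapL (u, μ)).V b - (mapL (u, μ)).V a := by
  have h := ((mapL_V_lipschitz u μ).lipschitzOnWith
    (s := uIcc a b)).absolutelyContinuousOnInterval
  exact ⟨h.intervalIntegrable_deriv, h.integral_deriv_eq_sub⟩

theorem integrable_deriv_mapL_V (ξ : ℝ) :
    IntegrableOn (deriv (mapL (u, μ)).V) (Iic ξ) := by
  refine integrableOn_Iic_of_intervalIntegral_norm_bounded (μ.real univ) ξ (l := atBot)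
    (a := fun x => x) (fun a => ?_) tendsto_id (Eventually.of_forall fun a => ?_)
  · rcases le_total a ξ with h | h
    · exact (intervalIntegrable_iff_integrableOn_Ioc_of_le h).1
        (intervalIntegral_deriv_mapL_V u μ a ξ).1
    · simp [Ioc_eq_empty (not_lt.2 h)]
  · simp_rw [Real.norm_of_nonneg (deriv_mapL_V_nonneg u μ _)]
    rw [(intervalIntegral_deriv_mapL_V u μ a ξ).2]
    linarith [mapL_V_le u μ ξ, mapL_V_nonneg u μ a]

theorem integral_Iic_deriv_mapL_V (ξ : ℝ) :
    ∫ η in Iic ξ, deriv (mapL (u, μ)).V η = (mapL (u, μ)).V ξ := by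
  have h1 := intervalIntegral_tendsto_integral_Iic ξ (integrable_deriv_mapL_V u μ ξ)
    (tendsto_id (α := ℝ) (x := atBot))
  have h2 : Tendsto (fun a => (mapL (u, μ)).V ξ - (mapL (u, μ)).V a) atBot
      (𝓝 ((mapL (u, μ)).V ξ - 0)) := tendsto_const_nhds.sub (tendsto_mapL_V_atBot u μ)
  rw [sub_zero] at h2
  refine tendsto_nhds_unique h1 (h2.congr fun a => ?_)
  exact (intervalIntegral_deriv_mapL_V u μ a ξ).2.symm

/-! ### Explicit solution of the conservative system -/

theorem lagrV_zero (s ξ : ℝ) : lagrV 0 (mapL (u, μ)) s ξ = (mapL (u, μ)).V ξ := by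
  simp only [lagrV, zero_mul, sub_zero, one_mul]
  exact integral_Iic_deriv_mapL_V u μ ξ

theorem lagrVinf_zero (s : ℝ) : lagrVinf 0 (mapL (u, μ)) s = μ.real univ := by
  rw [lagrVinf, funext (lagrV_zero u μ s)]
  exact (tendsto_mapL_V_atTop u μ).limUnder_eq

/-- `V` and `V_∞` are constant in time, so the acceleration is constant and characteristics are
quadratic in `t`. -/
theorem lagrY_zero (t ξ : ℝ) : lagrY 0 (mapL (u, μ)) t ξ = (mapL (u, μ)).y ξ
    + t * u ((mapL (u, μ)).y ξ)
    + t ^ 2 / 2 * ((mapL (u, μ)).V ξ / 2 - μ.real univ / 4) := by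
  have h : ∀ s, lagrU 0 (mapL (u, μ)) s ξ
      = u ((mapL (u, μ)).y ξ) + s * ((mapL (u, μ)).V ξ / 2 - μ.real univ / 4) := by
    intro s
    simp only [lagrU, lagrV_zero, lagrVinf_zero, intervalIntegral.integral_const, smul_eq_mul]
    change u ((mapL (u, μ)).y ξ) + _ = _
    ring
  simp only [lagrY, h]
  rw [intervalIntegral.integral_add (by simp)
    (Continuous.intervalIntegrable (by fun_prop) _ _),
    intervalIntegral.integral_const, intervalIntegral.integral_mul_const, integral_id]
  simp only [smul_eq_mul]
  ring

/-- The energy measure `V̄_ξ dξ` is the image of Lebesgue measure on `(0, μ(ℝ))` under any right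
inverse of `V̄`. -/
theorem map_rightInverse_mapL_V {X : ℝ → ℝ}
    (hX : ∀ v ∈ Ioo 0 (μ.real univ), (mapL (u, μ)).V (X v) = v) :
    AEMeasurable X (volume.restrict (Ioo 0 (μ.real univ))) ∧
    Measure.map X (volume.restrict (Ioo 0 (μ.real univ)))
      = volume.withDensity fun ξ => ENNReal.ofReal (deriv (mapL (u, μ)).V ξ) := by
  set M := μ.real univ
  have hmono : MonotoneOn X (Ioo 0 M) := by
    intro v hv w hw hvw
    by_contra! hlt
    have := mapL_V_mono u μ hlt.le
    rw [hX v hv, hX w hw] at this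
    exact absurd hlt (by rw [le_antisymm hvw this]; exact lt_irrefl _)
  have hmeas : AEMeasurable X (volume.restrict (Ioo 0 M)) :=
    aemeasurable_restrict_of_monotoneOn measurableSet_Ioo hmono
  refine ⟨hmeas, Measure.ext_of_Iic _ _ fun ξ => ?_⟩
  rw [withDensity_apply _ measurableSet_Iic,
    ← ofReal_integral_eq_lintegral_ofReal (integrable_deriv_mapL_V u μ ξ)
      (Eventually.of_forall (deriv_mapL_V_nonneg u μ)), integral_Iic_deriv_mapL_V,
    Measure.map_apply_of_aemeasurable hmeas measurableSet_Iic]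
  -- Monotonicity of `V̄` identifies the two sets except at the single level `v = V̄(ξ)`, where `X
  -- v` may lie to the right of `ξ` if `V̄` is flat there.
  have hae : X ⁻¹' Iic ξ =ᵐ[volume.restrict (Ioo 0 M)] Ioc 0 ((mapL (u, μ)).V ξ) := by
    have hne : ∀ᵐ v ∂(volume.restrict (Ioo 0 M)), v ≠ (mapL (u, μ)).V ξ :=
      ae_restrict_of_ae (Measure.ae_ne volume _)
    filter_upwards [hne, ae_restrict_mem measurableSet_Ioo] with v hv hvM
    refine propext ⟨fun h => ⟨hvM.1, ?_⟩, fun h => ?_⟩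
    · have := mapL_V_mono u μ (mem_Iic.1 (mem_preimage.1 h))
      rwa [hX v hvM] at this
    · change X v ≤ ξ
      by_contra! hlt
      have := mapL_V_mono u μ hlt.le
      rw [hX v hvM] at this
      exact hv (le_antisymm h.2 this)
  rw [measure_congr hae, Measure.restrict_apply measurableSet_Ioc]
  have hV := mapL_V_le u μ ξ
  have hsub : (Ioc 0 ((mapL (u, μ)).V ξ) ∩ Ioo 0 M : Set ℝ) =ᵐ[volume]
      (Ioc 0 ((mapL (u, μ)).V ξ) : Set ℝ) := by
    have hne : ∀ᵐ v ∂volume, v ≠ M := Measure.ae_ne volume _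
    filter_upwards [hne] with v hv
    refine propext ⟨fun h => h.1, fun h => ⟨h, h.1, lt_of_le_of_ne (h.2.trans hV) hv⟩⟩
  rw [measure_congr hsub, Real.volume_Ioc, sub_zero]

/-- For measurable data the evolved measure is the image of Lebesgue measure on `(0, μ(ℝ))` under
an explicit map, in terms of a generalised inverse `P` of the cumulative energy. -/
theorem exists_quantile_solT (hu : Measurable u) (t : ℝ) :
    ∃ P : ℝ → ℝ, (∀ v ∈ Ioo 0 (μ.real univ),
        (∀ x < P v, cumul μ x ≤ v) ∧ ∀ x > P v, v ≤ cumul μ x) ∧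
      AEMeasurable (fun v => P v + t * u (P v) + t ^ 2 / 2 * (v / 2 - μ.real univ / 4))
        (volume.restrict (Ioo 0 (μ.real univ))) ∧
      (solT 0 t (u, μ)).2 = Measure.map
        (fun v => P v + t * u (P v) + t ^ 2 / 2 * (v / 2 - μ.real univ / 4))
        (volume.restrict (Ioo 0 (μ.real univ))) := by
  -- Continuity of `V̄` and its limits at `±∞` give every intermediate level, including those
  -- skipped by jumps of `cumul μ`.
  have hsurj : ∀ v ∈ Ioo 0 (μ.real univ), ∃ ξ, (mapL (u, μ)).V ξ = v := by
    intro v hv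
    obtain ⟨a, ha⟩ := ((tendsto_mapL_V_atBot u μ).eventually_lt_const hv.1).exists
    obtain ⟨b, hb⟩ := ((tendsto_mapL_V_atTop u μ).eventually_const_lt hv.2).exists
    exact mem_range_of_exists_le_of_exists_ge (mapL_V_lipschitz u μ).continuous
      ⟨a, ha.le⟩ ⟨b, hb.le⟩
  choose! X hX using hsurj
  obtain ⟨hXm, hmap⟩ := map_rightInverse_mapL_V u μ hX
  have hy : Measurable (mapL (u, μ)).y := (mapL_y_mono u μ).measurable
  have hP : AEMeasurable (fun v => (mapL (u, μ)).y (X v))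
      (volume.restrict (Ioo 0 (μ.real univ))) := hy.comp_aemeasurable hXm
  have hU : AEMeasurable (fun v => u ((mapL (u, μ)).y (X v)))
      (volume.restrict (Ioo 0 (μ.real univ))) := hu.comp_aemeasurable hP
  refine ⟨fun v => (mapL (u, μ)).y (X v), fun v hv => ⟨fun x hx => ?_, fun x hx => ?_⟩, ?_, ?_⟩
  · exact (cumul_le_of_lt_mapL_y u μ hx).trans_eq (hX v hv)
  · exact (hX v hv).symm.trans_le (le_cumul_of_mapL_y_lt u μ hx)
  · fun_prop
  · have hY : Measurable (lagrY 0 (mapL (u, μ)) t) := by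
      rw [funext (lagrY_zero u μ t)]
      have hV : Measurable (mapL (u, μ)).V := (mapL_V_mono u μ).measurable
      have := hu.comp hy
      fun_prop
    change Measure.map (lagrY 0 (mapL (u, μ)) t)
      (volume.withDensity fun ξ => ENNReal.ofReal (deriv (lagrV 0 (mapL (u, μ)) t) ξ)) = _
    rw [funext (lagrV_zero u μ t), ← hmap,
      AEMeasurable.map_map_of_aemeasurable hY.aemeasurable hXm]
    refine Measure.map_congr ?_
    filter_upwards [ae_restrict_mem measurableSet_Ioo] with v hv
    rw [Function.comp_apply, lagrY_zero, hX v hv]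

end Lagrangian

end HunterSaxton

namespace HunterSaxton

/-! ### The projection -/

theorem cell_eq {Δx : ℝ} (h : 0 < Δx) {x : ℝ} {j : ℤ} (h1 : ((2 * j : ℤ) : ℝ) * Δx < x)
    (h2 : x ≤ ((2 * j + 2 : ℤ) : ℝ) * Δx) : cell Δx x = j := by
  have : ⌈x / (2 * Δx)⌉ = j + 1 := by
    push_cast at h1 h2
    rw [Int.ceil_eq_iff, lt_div_iff₀ (by linarith), div_le_iff₀ (by linarith)]
    push_cast
    constructor <;> linarith
  rw [cell, this]; ring

theorem cell_mono {Δx : ℝ} (h : 0 < Δx) : Monotone (cell Δx) := fun x y hxy =>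
  sub_le_sub_right (Int.ceil_mono (div_le_div_of_nonneg_right hxy (by linarith))) 1

/-- The slope of the projected wave profile on the left half of the cell `j`. -/
noncomputable def leftSlope (σ : ℤ → ℤˣ) (Δx : ℝ) (u : ℝ → ℝ) (μ : Measure ℝ) (j : ℤ) : ℝ :=
  diffQuot Δx u j - ((σ j : ℤ) : ℝ) * projQ Δx u μ j

/-- The slope of the projected wave profile on the right half of the cell `j`. -/
noncomputable def rightSlope (σ : ℤ → ℤˣ) (Δx : ℝ) (u : ℝ → ℝ) (μ : Measure ℝ) (j : ℤ) : ℝ :=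
  diffQuot Δx u j + ((σ j : ℤ) : ℝ) * projQ Δx u μ j

/-- The broken line with initial value `c`, slope `p` on `[0, Δ]` and slope `q` afterwards. -/
noncomputable def brokenLine (Δ c p q w : ℝ) : ℝ := c + p * min w Δ + q * max (w - Δ) 0

theorem continuous_brokenLine (Δ c p q : ℝ) : Continuous (brokenLine Δ c p q) := by
  unfold brokenLine; fun_prop

theorem brokenLine_mono (Δ c : ℝ) {p q : ℝ} (hp : 0 ≤ p) (hq : 0 ≤ q) :
    Monotone (brokenLine Δ c p q) := fun v w h => by
  unfold brokenLine; gcongr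

theorem brokenLine_zero {Δ : ℝ} (hΔ : 0 ≤ Δ) (c p q : ℝ) : brokenLine Δ c p q 0 = c := by
  simp [brokenLine, hΔ]

section

variable {u : ℝ → ℝ} {μ : Measure ℝ} (hD : InD u μ) {Δx : ℝ} (hΔx : 0 < Δx) (σ : ℤ → ℤˣ)

include hΔx in
-- The two half-cell formulas meet at the midpoint because the slopes average to the difference
-- quotient.
theorem projU_eq (x : ℝ) :
    projU σ Δx u μ x = brokenLine Δx (gridVal Δx u (2 * cell Δx x))
      (leftSlope σ Δx u μ (cell Δx x)) (rightSlope σ Δx u μ (cell Δx x))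
      (x - ((2 * cell Δx x : ℤ) : ℝ) * Δx) := by
  have hd : gridVal Δx u (2 * cell Δx x + 2)
      = gridVal Δx u (2 * cell Δx x) + diffQuot Δx u (cell Δx x) * (2 * Δx) := by
    rw [diffQuot]; field_simp; ring
  simp only [projU, brokenLine, leftSlope, rightSlope]
  split_ifs with h <;> push_cast at h ⊢
  · rw [min_eq_left (by linarith), max_eq_right (by linarith)]; ring
  · rw [min_eq_right (by linarith), max_eq_left (by linarith), hd]; ring

include hD hΔx in
-- The Hölder estimate on the cell makes the radicand nonnegative, so the real square root is not
-- truncated to 0.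
theorem projQ_sq (j : ℤ) :
    projQ Δx u μ j ^ 2 = diffQuot Δx (cumul (acPart μ)) j - diffQuot Δx u j ^ 2 := by
  refine Real.sq_sqrt (sub_nonneg.2 ?_)
  have h := hD.sq_sub_le (a := ((2 * j : ℤ) : ℝ) * Δx) (b := ((2 * j + 2 : ℤ) : ℝ) * Δx)
    (by push_cast; linarith)
  rw [show ((2 * j + 2 : ℤ) : ℝ) * Δx - ((2 * j : ℤ) : ℝ) * Δx = 2 * Δx by push_cast; ring] at h
  simp only [diffQuot, gridVal]
  rw [div_pow, div_le_div_iff₀ (by positivity) (by positivity)]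
  nlinarith

include hD hΔx in
-- Energy balance on a cell: the cross terms in `(Du ∓ σq)²` cancel and `σ² = 1`, leaving `2(Du² +
-- q²) = 2 DF_ac`.
theorem slopes_sq_add_sq (j : ℤ) :
    (leftSlope σ Δx u μ j ^ 2 + rightSlope σ Δx u μ j ^ 2) * Δx
      = gridVal Δx (cumul (acPart μ)) (2 * j + 2) - gridVal Δx (cumul (acPart μ)) (2 * j) := by
  have hs : ((σ j : ℤ) : ℝ) ^ 2 = 1 := by
    rcases Int.units_eq_one_or (σ j) with h | h <;> simp [h]
  have hq := projQ_sq hD hΔx j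
  have hF : diffQuot Δx (cumul (acPart μ)) j * (2 * Δx) = gridVal Δx (cumul (acPart μ)) (2 * j + 2)
      - gridVal Δx (cumul (acPart μ)) (2 * j) := div_mul_cancel₀ _ (by positivity)
  rw [← hF, leftSlope, rightSlope]
  linear_combination 2 * projQ Δx u μ j ^ 2 * Δx * hs + 2 * Δx * hq

include hD hΔx in
theorem projFac_eq (x : ℝ) :
    projFac σ Δx u μ x = brokenLine Δx (gridVal Δx (cumul (acPart μ)) (2 * cell Δx x))
      (leftSlope σ Δx u μ (cell Δx x) ^ 2) (rightSlope σ Δx u μ (cell Δx x) ^ 2)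
      (x - ((2 * cell Δx x : ℤ) : ℝ) * Δx) := by
  have h := slopes_sq_add_sq hD hΔx σ (cell Δx x)
  simp only [projFac, brokenLine, leftSlope, rightSlope] at h ⊢
  split_ifs with hx <;> push_cast at hx ⊢
  · rw [min_eq_left (by linarith), max_eq_right (by linarith)]; ring
  · rw [min_eq_right (by linarith), max_eq_left (by linarith)]
    linear_combination (-1 / 2 : ℝ) * h

/-! ### Cumulative energy of the projected data -/

include hΔx in
theorem projF_grid (hD : InD u μ) (k : ℤ) :
    projF σ Δx u μ (((2 * k : ℤ) : ℝ) * Δx) = cumul μ (((2 * k : ℤ) : ℝ) * Δx) := by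
  have := hD.finite
  -- Cells are open on the left and closed on the right, so a mesh point is the right end of the
  -- preceding cell.
  have hc : cell Δx (((2 * k : ℤ) : ℝ) * Δx) = k - 1 :=
    cell_eq hΔx (by push_cast; linarith) (by push_cast; linarith)
  have h := slopes_sq_add_sq hD hΔx σ (k - 1)
  rw [projF, projFac_eq hD hΔx, projFsing, hc, ← cumul_acPart_add_singPart,
    show 2 * (k - 1) + 2 = 2 * k by ring] at *
  simp only [brokenLine]
  rw [show ((2 * k : ℤ) : ℝ) * Δx - ((2 * (k - 1) : ℤ) : ℝ) * Δx = 2 * Δx by push_cast; ring,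
    min_eq_right (by linarith), max_eq_left (by linarith)]
  simp only [gridVal] at h ⊢
  linear_combination h

include hD hΔx in
theorem projF_eq (x : ℝ) :
    projF σ Δx u μ x = brokenLine Δx (gridVal Δx (cumul (acPart μ)) (2 * cell Δx x))
      (leftSlope σ Δx u μ (cell Δx x) ^ 2) (rightSlope σ Δx u μ (cell Δx x) ^ 2)
      (x - ((2 * cell Δx x : ℤ) : ℝ) * Δx)
      + gridVal Δx (cumul (singPart μ)) (2 * cell Δx x + 2) := by
  rw [projF, projFac_eq hD hΔx, projFsing]

include hD hΔx in
-- With `le_projF`, this traps the projected energy between the values of `cumul μ` at the ends of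
-- the cell. Monotonicity across cells and both limits at infinity follow.
theorem projF_le (x : ℝ) :
    projF σ Δx u μ x ≤ cumul μ (((2 * cell Δx x + 2 : ℤ) : ℝ) * Δx) := by
  have hj : cell Δx (((2 * cell Δx x + 2 : ℤ) : ℝ) * Δx) = cell Δx x :=
    cell_eq hΔx (by push_cast; linarith) le_rfl
  have hg := projF_grid hΔx σ hD (cell Δx x + 1)
  rw [show 2 * (cell Δx x + 1) = 2 * cell Δx x + 2 by ring] at hg
  rw [← hg, projF_eq hD hΔx, projF_eq hD hΔx, hj]
  have := (cell_spec hΔx x).2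
  gcongr
  exact brokenLine_mono _ _ (sq_nonneg _) (sq_nonneg _) (by linarith)

include hD hΔx in
theorem le_projF (x : ℝ) :
    cumul μ (((2 * cell Δx x : ℤ) : ℝ) * Δx) ≤ projF σ Δx u μ x := by
  have := hD.finite
  have : IsFiniteMeasure (singPart μ) := by unfold singPart; infer_instance
  rw [projF_eq hD hΔx, ← cumul_acPart_add_singPart]
  have h1 := (cell_spec hΔx x).1
  have h2 := brokenLine_mono Δx (gridVal Δx (cumul (acPart μ)) (2 * cell Δx x))
    (sq_nonneg (leftSlope σ Δx u μ (cell Δx x)))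
    (sq_nonneg (rightSlope σ Δx u μ (cell Δx x))) (sub_nonneg.2 h1.le)
  rw [brokenLine_zero hΔx.le] at h2
  refine add_le_add h2 (cumul_mono _ ?_)
  push_cast; linarith

include hD hΔx in
theorem projF_mono : Monotone (projF σ Δx u μ) := by
  have := hD.finite
  intro x y hxy
  rcases (cell_mono hΔx hxy).eq_or_lt with h | h
  · rw [projF_eq hD hΔx, projF_eq hD hΔx, h]
    gcongr
    exact brokenLine_mono _ _ (sq_nonneg _) (sq_nonneg _) (by linarith)
  · refine (projF_le hD hΔx σ x).trans ((cumul_mono μ ?_).trans (le_projF hD hΔx σ y))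
    have : ((2 * cell Δx x + 2 : ℤ) : ℝ) ≤ ((2 * cell Δx y : ℤ) : ℝ) := by
      exact_mod_cast (by omega)
    exact mul_le_mul_of_nonneg_right this hΔx.le

include hD hΔx in
-- The cell index is constant immediately to the left of every point, since cells are closed on the
-- right.
theorem projF_leftContinuous (x : ℝ) : ContinuousWithinAt (projF σ Δx u μ) (Iio x) x := by
  have hc : Continuous fun z => brokenLine Δx (gridVal Δx (cumul (acPart μ)) (2 * cell Δx x))
      (leftSlope σ Δx u μ (cell Δx x) ^ 2) (rightSlope σ Δx u μ (cell Δx x) ^ 2)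
      (z - ((2 * cell Δx x : ℤ) : ℝ) * Δx)
      + gridVal Δx (cumul (singPart μ)) (2 * cell Δx x + 2) :=
    ((continuous_brokenLine _ _ _ _).comp (by fun_prop)).add continuous_const
  refine hc.continuousWithinAt.congr_of_eventuallyEq ?_ (projF_eq hD hΔx σ x)
  have hx := cell_spec hΔx x
  filter_upwards [self_mem_nhdsWithin, mem_nhdsWithin_of_mem_nhds (Ioi_mem_nhds hx.1)]
    with z hz hz'
  rw [projF_eq hD hΔx, cell_eq hΔx hz' ((le_of_lt hz).trans hx.2)]

include hD hΔx in
theorem tendsto_projF_atBot : Tendsto (projF σ Δx u μ) atBot (𝓝 0) := by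
  have := hD.finite
  have h : Tendsto (fun x => cumul μ (x + 2 * Δx)) atBot (𝓝 0) :=
    (tendsto_cumul_atBot μ).comp (tendsto_atBot_add_const_right _ _ tendsto_id)
  refine tendsto_of_tendsto_of_tendsto_of_le_of_le tendsto_const_nhds h
    (fun x => (cumul_nonneg μ _).trans (le_projF hD hΔx σ x))
    fun x => (projF_le hD hΔx σ x).trans (cumul_mono μ ?_)
  have := (cell_spec hΔx x).1
  push_cast at this ⊢; linarith

include hD hΔx in
theorem tendsto_projF_atTop : Tendsto (projF σ Δx u μ) atTop (𝓝 (μ.real univ)) := by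
  have := hD.finite
  have h : Tendsto (fun x => cumul μ (x + -(2 * Δx))) atTop (𝓝 (μ.real univ)) :=
    (tendsto_cumul_atTop μ).comp (tendsto_atTop_add_const_right _ _ tendsto_id)
  refine tendsto_of_tendsto_of_tendsto_of_le_of_le h tendsto_const_nhds
    (fun x => (cumul_mono μ ?_).trans (le_projF hD hΔx σ x))
    fun x => (projF_le hD hΔx σ x).trans (cumul_le μ _)
  have := (cell_spec hΔx x).2
  push_cast at this ⊢; linarith

include hD hΔx in
theorem isFiniteMeasure_proj : IsFiniteMeasure (proj σ Δx (u, μ)).2 := by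
  have := hD.finite
  have hF := projF_mono hD hΔx σ
  change IsFiniteMeasure (measureOfCumul (projF σ Δx u μ))
  rw [measureOfCumul, dif_pos hF]
  refine StieltjesFunction.isFiniteMeasure_of_forall_abs_le _ (C := μ.real univ) fun x => ?_
  have h0 : ∀ z, 0 ≤ projF σ Δx u μ z := fun z =>
    (cumul_nonneg μ _).trans (le_projF hD hΔx σ z)
  have h1 : ∀ z, projF σ Δx u μ z ≤ μ.real univ := fun z =>
    (projF_le hD hΔx σ z).trans (cumul_le μ _)
  -- The Stieltjes function is the right-limit version of `projF`, hence it is squeezed between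
  -- values of `projF` at `x` and `x + 1`.
  have hl : projF σ Δx u μ x ≤ hF.stieltjesFunction x := hF.le_rightLim le_rfl
  have hr : hF.stieltjesFunction x ≤ projF σ Δx u μ (x + 1) := hF.rightLim_le (by simp)
  rw [abs_le]
  constructor <;> linarith [h0 x, h1 x, h1 (x + 1)]

include hD hΔx in
theorem cumul_proj (x : ℝ) : cumul (proj σ Δx (u, μ)).2 x = projF σ Δx u μ x :=
  cumul_measureOfCumul (projF_mono hD hΔx σ) (projF_leftContinuous hD hΔx σ)
    (tendsto_projF_atBot hD hΔx σ) x

include hD hΔx in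
theorem real_univ_proj : (proj σ Δx (u, μ)).2.real univ = μ.real univ := by
  have := isFiniteMeasure_proj hD hΔx σ
  refine tendsto_nhds_unique (tendsto_cumul_atTop (proj σ Δx (u, μ)).2) ?_
  rw [funext (cumul_proj hD hΔx σ)]
  exact tendsto_projF_atTop hD hΔx σ

include hΔx in
-- Measurability is all that `exists_quantile_solT` asks of the profile, so membership of the
-- projected pair in `𝒟` is never needed.
theorem measurable_projU : Measurable (projU σ Δx u μ) := by
  have hc : Measurable (cell Δx) := (cell_mono hΔx).measurable
  have hf : ∀ f : ℤ → ℝ, Measurable fun x => f (cell Δx x) := fun f =>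
    (measurable_of_countable f).comp hc
  rw [funext (projU_eq hΔx σ)]
  unfold brokenLine
  have h1 := hf fun j => gridVal Δx u (2 * j)
  have h2 := hf (leftSlope σ Δx u μ)
  have h3 := hf (rightSlope σ Δx u μ)
  have h4 := hf fun j => ((2 * j : ℤ) : ℝ) * Δx
  fun_prop

/-! ### Oscillation of both profiles on a cell -/

include hD in
theorem acPart_increment_le (j : ℤ) :
    gridVal Δx (cumul (acPart μ)) (2 * j + 2) - gridVal Δx (cumul (acPart μ)) (2 * j)
      ≤ μ.real univ := by
  have := hD.finite
  have hle : (acPart μ).real univ ≤ μ.real univ :=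
    ENNReal.toReal_mono (measure_ne_top μ _) (acPart_le μ _)
  have : IsFiniteMeasure (acPart μ) := isFiniteMeasure_of_le μ (acPart_le μ)
  exact (sub_le_self _ (cumul_nonneg _ _)).trans ((cumul_le _ _).trans hle)

include hD hΔx in
theorem abs_sub_gridVal_le {j : ℤ} {x : ℝ}
    (hx : x ∈ Icc (((2 * j : ℤ) : ℝ) * Δx) (((2 * j + 2 : ℤ) : ℝ) * Δx)) :
    |u x - gridVal Δx u (2 * j)| ≤ √(2 * Δx * μ.real univ) := by
  have := hD.finite
  have : IsFiniteMeasure (acPart μ) := isFiniteMeasure_of_le μ (acPart_le μ)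
  refine Real.abs_le_sqrt ((hD.sq_sub_le hx.1).trans ?_)
  have h1 := acPart_increment_le (Δx := Δx) hD j
  have h2 := cumul_mono (acPart μ) hx.2
  simp only [gridVal] at h1
  have h3 := hx.2
  refine mul_le_mul ?_ (by linarith) (sub_nonneg.2 (cumul_mono _ hx.1)) (by positivity)
  push_cast at h3 ⊢; linarith

include hD hΔx in
-- Cauchy–Schwarz in the plane: the increment pairs the two slopes with two lengths of at most `Δx`,
-- and the slopes carry the cell's energy. The left endpoint belongs to the previous cell and is
-- treated separately.
theorem abs_projU_sub_gridVal_le {j : ℤ} {x : ℝ}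
    (hx : x ∈ Icc (((2 * j : ℤ) : ℝ) * Δx) (((2 * j + 2 : ℤ) : ℝ) * Δx)) :
    |projU σ Δx u μ x - gridVal Δx u (2 * j)| ≤ √(2 * Δx * μ.real univ) := by
  refine Real.abs_le_sqrt ?_
  rcases hx.1.eq_or_lt with h | h
  · have hc : cell Δx x = j - 1 :=
      cell_eq hΔx (by rw [← h]; push_cast; linarith) (by rw [← h]; push_cast; linarith)
    have : projU σ Δx u μ x = gridVal Δx u (2 * j) := by
      have hn : ¬ x ≤ ((2 * (j - 1) + 1 : ℤ) : ℝ) * Δx := by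
        rw [← h]; push_cast; linarith
      simp only [projU, hc]
      rw [if_neg hn, show 2 * (j - 1) + 2 = 2 * j by ring, ← h]
      simp
    rw [this, sub_self, zero_pow two_ne_zero]
    positivity
  · rw [projU_eq hΔx, cell_eq hΔx h hx.2, brokenLine, add_assoc, add_sub_cancel_left]
    have hx2 := hx.2
    set w := x - ((2 * j : ℤ) : ℝ) * Δx with hw
    have hw0 : 0 < w := sub_pos.2 h
    have hw1 : w ≤ 2 * Δx := by rw [hw]; push_cast at hx2 ⊢; linarith
    have hm : min w Δx ^ 2 ≤ Δx ^ 2 :=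
      pow_le_pow_left₀ (le_min hw0.le hΔx.le) (min_le_right _ _) 2
    have hn : max (w - Δx) 0 ^ 2 ≤ Δx ^ 2 :=
      pow_le_pow_left₀ (le_max_right _ _) (max_le (by linarith) hΔx.le) 2
    set A := leftSlope σ Δx u μ j
    set B := rightSlope σ Δx u μ j
    have hAB : (A ^ 2 + B ^ 2) * Δx ≤ μ.real univ :=
      (slopes_sq_add_sq hD hΔx σ j).trans_le (acPart_increment_le hD j)
    calc (A * min w Δx + B * max (w - Δx) 0) ^ 2
        ≤ (A ^ 2 + B ^ 2) * (min w Δx ^ 2 + max (w - Δx) 0 ^ 2) := by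
          nlinarith [sq_nonneg (A * max (w - Δx) 0 - B * min w Δx)]
      _ ≤ (A ^ 2 + B ^ 2) * (Δx ^ 2 + Δx ^ 2) := by gcongr
      _ = 2 * Δx * ((A ^ 2 + B ^ 2) * Δx) := by ring
      _ ≤ 2 * Δx * μ.real univ := by gcongr

end

end HunterSaxton

namespace HunterSaxton

/-! ### The error estimate -/

theorem norm_le_of_normBL_le_one {ψ : ℝ → ℝ} (h : normBL ψ ≤ 1) (x : ℝ) : |ψ x| ≤ 1 := by
  have h1 : ENNReal.ofReal |ψ x| ≤ 1 :=
    ((le_iSup (fun x : ℝ => ENNReal.ofReal |ψ x|) x).trans le_self_add).trans h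
  exact ENNReal.ofReal_le_one.1 h1

theorem abs_sub_le_of_normBL_le_one {ψ : ℝ → ℝ} (h : normBL ψ ≤ 1) (x y : ℝ) :
    |ψ x - ψ y| ≤ |x - y| := by
  rcases eq_or_ne x y with rfl | hxy
  · simp
  · have h1 : ENNReal.ofReal (|ψ x - ψ y| / |x - y|) ≤ 1 := by
      refine le_trans ?_ ((le_add_self).trans h)
      exact le_iSup_of_le x (le_iSup_of_le y (le_iSup_of_le hxy le_rfl))
    rwa [ENNReal.ofReal_le_one, div_le_one (abs_pos.2 (sub_ne_zero.2 hxy))] at h1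

/-- The bounded Lipschitz distance of two images of a finite measure is controlled by the
distance of the maps. -/
theorem dBL_map_le {α : Type*} [MeasurableSpace α] (m : Measure α) [IsFiniteMeasure m]
    {Y Z : α → ℝ} (hY : AEMeasurable Y m) (hZ : AEMeasurable Z m) {C : ℝ}
    (hC : ∀ᵐ v ∂m, |Y v - Z v| ≤ C) :
    dBL (Measure.map Y m) (Measure.map Z m) ≤ ((m.real univ * C : ℝ) : EReal) := by
  refine iSup₂_le fun ψ hψ => EReal.coe_le_coe_iff.2 ?_
  have hc : Continuous ψ := by
    refine LipschitzWith.continuous (K := 1) (LipschitzWith.of_dist_le_mul fun x y => ?_)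
    simpa [Real.dist_eq] using abs_sub_le_of_normBL_le_one hψ x y
  have hi : ∀ W : α → ℝ, AEMeasurable W m → Integrable (fun v => ψ (W v)) m := fun W hW =>
    Integrable.of_bound (hc.measurable.comp_aemeasurable hW).aestronglyMeasurable 1
      (Eventually.of_forall fun v => norm_le_of_normBL_le_one hψ _)
  rw [integral_map hY hc.aestronglyMeasurable, integral_map hZ hc.aestronglyMeasurable,
    ← integral_sub (hi Y hY) (hi Z hZ), ← smul_eq_mul, ← integral_const]
  refine integral_mono_ae ((hi Y hY).sub (hi Z hZ)) (integrable_const _) ?_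
  filter_upwards [hC] with v hv
  exact (le_abs_self _).trans ((abs_sub_le_of_normBL_le_one hψ _ _).trans hv)

/-- An energy level that is not attained at a mesh point belongs to exactly one cell. -/
theorem exists_cell_of_level (μ : Measure ℝ) [IsFiniteMeasure μ] {Δx : ℝ} (hΔx : 0 < Δx) {v : ℝ}
    (hv : v ∈ Ioo 0 (μ.real univ)) (hne : ∀ k : ℤ, v ≠ cumul μ (((2 * k : ℤ) : ℝ) * Δx)) :
    ∃ j : ℤ, cumul μ (((2 * j : ℤ) : ℝ) * Δx) < v ∧
      v < cumul μ (((2 * j + 2 : ℤ) : ℝ) * Δx) := by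
  have hmono : ∀ {k l : ℤ}, k ≤ l →
      cumul μ (((2 * k : ℤ) : ℝ) * Δx) ≤ cumul μ (((2 * l : ℤ) : ℝ) * Δx) := fun h =>
    cumul_mono μ (mul_le_mul_of_nonneg_right (by exact_mod_cast (by omega)) hΔx.le)
  obtain ⟨a, ha⟩ := ((tendsto_cumul_atBot μ).eventually_lt_const hv.1).exists
  obtain ⟨b, hb⟩ := ((tendsto_cumul_atTop μ).eventually_const_lt hv.2).exists
  have hbdd : ∀ k : ℤ, cumul μ (((2 * k : ℤ) : ℝ) * Δx) < v → k ≤ cell Δx b + 1 := by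
    intro k hk
    by_contra! hlt
    have h1 := cumul_mono μ (cell_spec hΔx b).2
    rw [show 2 * cell Δx b + 2 = 2 * (cell Δx b + 1) by ring] at h1
    exact absurd (hb.trans_le (h1.trans (hmono hlt.le))) (not_lt.2 hk.le)
  -- Take the last even mesh point whose energy is below `v`; at the next one the energy is at least
  -- `v`, and equality is excluded by `hne`.
  obtain ⟨j, hj, hmax⟩ := Int.exists_greatest_of_bdd ⟨_, hbdd⟩
    ⟨cell Δx a, (cumul_mono μ (cell_spec hΔx a).1.le).trans_lt ha⟩
  refine ⟨j, hj, ?_⟩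
  rw [show 2 * j + 2 = 2 * (j + 1) by ring]
  refine lt_of_le_of_ne (not_lt.1 fun h => ?_) (hne (j + 1))
  have := hmax (j + 1) h
  omega

theorem mem_cell_of_level {F : ℝ → ℝ} {a b p v : ℝ} (ha : F a < v) (hb : v < F b)
    (h1 : ∀ x < p, F x ≤ v) (h2 : ∀ x > p, v ≤ F x) : p ∈ Icc a b :=
  ⟨not_lt.1 fun h => absurd (h2 a h) (not_le.2 ha), not_lt.1 fun h => absurd (h1 b h) (not_le.2 hb)⟩

/-- Both evolved measures are compared at the same energy level `v`, so the acceleration terms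
coincide and only initial positions and velocities contribute. -/
theorem solT_proj_estimate {u : ℝ → ℝ} {μ : Measure ℝ} (hD : InD u μ) {Δx : ℝ} (hΔx : 0 < Δx)
    (σ : ℤ → ℤˣ) {t : ℝ} (ht : 0 ≤ t) :
    IsFiniteMeasure (solT 0 t (u, μ)).2 ∧ IsFiniteMeasure (solT 0 t (proj σ Δx (u, μ))).2 ∧
    dBL (solT 0 t (u, μ)).2 (solT 0 t (proj σ Δx (u, μ))).2
      ≤ ((μ.real univ * (2 * Δx + t * (2 * √(2 * Δx * μ.real univ))) : ℝ) : EReal) := by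
  have := hD.finite
  have := isFiniteMeasure_proj hD hΔx σ
  obtain ⟨P, hP, hYm, hY⟩ := exists_quantile_solT u μ hD.u_mem.continuous.measurable t
  obtain ⟨Q, hQ, hZm, hZ⟩ := exists_quantile_solT (proj σ Δx (u, μ)).1 (proj σ Δx (u, μ)).2
    (measurable_projU hΔx σ) t
  -- Equal total mass puts both quantile maps on the same interval and makes their accelerations
  -- equal.
  rw [real_univ_proj hD hΔx σ] at hQ hZm hZ
  change (solT 0 t (proj σ Δx (u, μ))).2 = _ at hZ
  rw [hY, hZ]
  refine ⟨inferInstance, inferInstance, (dBL_map_le _ hYm hZm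
    (C := 2 * Δx + t * (2 * √(2 * Δx * μ.real univ))) ?_).trans_eq ?_⟩
  -- At a level attained at a mesh point, flat stretches could put `P v` and `Q v` in different
  -- cells; there are only countably many such levels.
  · have hne : ∀ᵐ v ∂(volume.restrict (Ioo 0 (μ.real univ))),
        ∀ k : ℤ, v ≠ cumul μ (((2 * k : ℤ) : ℝ) * Δx) :=
      ae_all_iff.2 fun k => ae_restrict_of_ae (Measure.ae_ne volume _)
    filter_upwards [hne, ae_restrict_mem measurableSet_Ioo] with v hv hvM
    obtain ⟨j, hj1, hj2⟩ := exists_cell_of_level μ hΔx hvM hv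
    have hp := mem_cell_of_level hj1 hj2 (hP v hvM).1 (hP v hvM).2
    have hq : Q v ∈ Icc (((2 * j : ℤ) : ℝ) * Δx) (((2 * j + 2 : ℤ) : ℝ) * Δx) := by
      refine mem_cell_of_level (F := cumul (proj σ Δx (u, μ)).2) ?_ ?_ (hQ v hvM).1 (hQ v hvM).2
      · rwa [cumul_proj hD hΔx, projF_grid hΔx σ hD]
      · rw [show 2 * j + 2 = 2 * (j + 1) by ring] at hj2 ⊢
        rwa [cumul_proj hD hΔx, projF_grid hΔx σ hD]
    have e1 : |P v - Q v| ≤ 2 * Δx := by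
      refine (abs_sub_le_of_le_of_le hp.1 hp.2 hq.1 hq.2).trans_eq ?_
      push_cast; ring
    have e2 : |u (P v) - projU σ Δx u μ (Q v)| ≤ 2 * √(2 * Δx * μ.real univ) := by
      have h1 := abs_sub_gridVal_le hD hΔx hp
      have h2 := abs_projU_sub_gridVal_le hD hΔx σ hq
      rw [abs_sub_comm] at h2
      linarith [abs_sub_le (u (P v)) (gridVal Δx u (2 * j)) (projU σ Δx u μ (Q v))]
    calc |P v + t * u (P v) + t ^ 2 / 2 * (v / 2 - μ.real univ / 4)
          - (Q v + t * (proj σ Δx (u, μ)).1 (Q v) + t ^ 2 / 2 * (v / 2 - μ.real univ / 4))|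
        = |(P v - Q v) + t * (u (P v) - projU σ Δx u μ (Q v))| := by
          congr 1
          change _ - (Q v + t * projU σ Δx u μ (Q v) + _) = _
          ring
      _ ≤ |P v - Q v| + |t * (u (P v) - projU σ Δx u μ (Q v))| := abs_add_le _ _
      _ ≤ 2 * Δx + t * (2 * √(2 * Δx * μ.real univ)) := by
          rw [abs_mul, abs_of_nonneg ht]
          gcongr
  · simp [Real.volume_real_Ioo_of_le measureReal_nonneg]

end HunterSaxton

theorem lemma5p2 (u : ℝ → ℝ) (μ : MeasureTheory.Measure ℝ) (hD : HunterSaxton.InD u μ)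
    (Δx : ℝ) (hΔx : 0 < Δx) (σ : ℤ → ℤˣ) (t : ℝ) (ht : 0 ≤ t) :
    MeasureTheory.IsFiniteMeasure (HunterSaxton.solT 0 t (u, μ)).2 ∧
    MeasureTheory.IsFiniteMeasure
      (HunterSaxton.solT 0 t (HunterSaxton.proj σ Δx (u, μ))).2 ∧
    HunterSaxton.dBL (HunterSaxton.solT 0 t (u, μ)).2
        (HunterSaxton.solT 0 t (HunterSaxton.proj σ Δx (u, μ))).2 ≤
      (((1 + 2 * √2) * t * μ.real Set.univ ^ (3 / 2 : ℝ) * Δx ^ (1 / 2 : ℝ)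
        + (2 + t ^ 2 / 2 + 4 * Real.exp (t / 2)) * μ.real Set.univ * Δx : ℝ) : EReal) := by
  obtain ⟨h1, h2, h3⟩ := HunterSaxton.solT_proj_estimate hD hΔx σ ht
  refine ⟨h1, h2, h3.trans (EReal.coe_le_coe_iff.2 ?_)⟩
  have hM : 0 ≤ μ.real Set.univ := MeasureTheory.measureReal_nonneg
  generalize μ.real Set.univ = M at hM
  have hpow : M ^ (3 / 2 : ℝ) = M * √M := by
    rw [show (3 / 2 : ℝ) = 1 + 1 / 2 by norm_num, Real.rpow_add_of_nonneg hM (by norm_num)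
      (by norm_num), Real.rpow_one, Real.sqrt_eq_rpow]
  rw [hpow, ← Real.sqrt_eq_rpow, Real.sqrt_mul (by positivity), Real.sqrt_mul (by norm_num)]
  -- `e1` and `e2` are the parts of the stated bound left over after the sharper estimate.
  have e1 : 0 ≤ t * (M * √M) * √Δx := by positivity
  have e2 : 0 ≤ (t ^ 2 / 2 + 4 * Real.exp (t / 2)) * M * Δx := by positivity
  linarith
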